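/- There are universal constants $c, K > 0$ such that the following holds for all integers $s \ge 1$ and $T \ge 2$ and all real $\beta$ with $\frac{\log(3s)}{\log T} < \beta \le 1$. There is a random sequence (with finitely many outcomes) of piecewise constant utility functions $u_1, \dots, u_T : [0,1] \to [0,1]$ such that (i) every outcome of the sequence is $\beta$-dispersed for the Lipschitz constant $0$, with constant $K$: for all $\epsilon \ge T^{-\beta}$ and all $\rho \in [0,1]$, at most $K \epsilon T$ of the functions $u_1, \dots, u_T$ are not constant on $\{x \in [0,1] : |x - \rho| \le \epsilon\}$; and (ii) every (possibly randomized) online algorithm, which in round $t$ chooses $\rho_t \in [0,1]$ from $u_1, \dots, u_{t-1}$ and its own randomness (independent of the sequence), has $s$-shifted regret $$\mathbb{E}\left[\sup_{\substack{\rho_1^*,\dots,\rho_s^* \in [0,1] \\ 1 = t_0 < t_1 < \dots < t_s = T+1}} \ \sum_{i=1}^{s} \sum_{t=t_{i-1}}^{t_i - 1} \bigl(u_t(\rho_i^*) - u_t(\rho_t)\bigr)\right] \ \ge\ c \left(\sqrt{sT} + s\,T^{1-\beta}\right).$$ -/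

import Mathlib

open MeasureTheory
open scoped NNReal

/-- `f : [0,1] → ℝ` is piecewise constant: `[0,1]` is the union of finitely many intervals
(order-connected sets) on each of which `f` is constant. -/
def IsPiecewiseConstant (f : unitInterval → ℝ) : Prop :=
  ∃ (n : ℕ) (J : Fin n → Set unitInterval),
    (∀ i, (J i).OrdConnected) ∧ (⋃ i, J i) = Set.univ ∧
      ∀ i, ∀ x ∈ J i, ∀ y ∈ J i, f x = f y

/-- The sequence `u` of `T` utility functions on `C` is `β`-dispersed for the Lipschitz constant
`L`, with leading constant `K`: for all `ε ≥ T ^ (-β)` and every centre `ρ ∈ C`, at most `K ε T`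
of the functions fail to be `L`-Lipschitz on the ball of radius `ε` around `ρ`.
(The ball is a ball of the metric space `C` itself; for a subset `C` of a larger space it is the
intersection of the ball with `C`, whether or not the whole ball is contained in `C`.) -/
def IsDispersed {C : Type*} [PseudoMetricSpace C] {T : ℕ} (β : ℝ) (L : ℝ≥0) (K : ℝ)
    (u : Fin T → C → ℝ) : Prop :=
  ∀ ε : ℝ, (T : ℝ) ^ (-β) ≤ ε → ∀ ρ : C,
    ({t : Fin T | ¬ LipschitzOnWith L (u t) (Metric.closedBall ρ ε)}.ncard : ℝ) ≤ K * ε * T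

/-- A randomized online algorithm with full information on the decision set `C`, whose internal
randomness is a seed in `Ξ`. After `t` rounds it has seen `t` utility functions, and it picks its
next point from them and from the seed. (Its own earlier points are functions of the same data.
A deterministic algorithm is one that ignores the seed.) -/
structure OnlineAlgorithm (C Ξ : Type*) [MeasurableSpace C] [MeasurableSpace Ξ] where
  play : (t : ℕ) → (Fin t → C → ℝ) → Ξ → C
  measurable_play : ∀ (t : ℕ) (h : Fin t → C → ℝ), Measurable (play t h)

/-- The points `ρ_t` that the algorithm plays against `u` with seed `ξ`; the one for index `t`
depends only on the utility functions of the rounds before `t`. -/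
def OnlineAlgorithm.points {C Ξ : Type*} [MeasurableSpace C] [MeasurableSpace Ξ]
    (A : OnlineAlgorithm C Ξ) {T : ℕ} (u : Fin T → C → ℝ) (ξ : Ξ) (t : Fin T) : C :=
  A.play t (fun i => u (Fin.castLE t.isLt.le i)) ξ

/-- `τ` splits the `T` rounds `0, …, T - 1` into `s` consecutive nonempty phases, the `i`-th one
consisting of the rounds `t` with `τ i ≤ t < τ (i + 1)`. -/
def IsPhaseSplit (T s : ℕ) (τ : Fin (s + 1) → ℕ) : Prop :=
  τ 0 = 0 ∧ StrictMono τ ∧ τ (Fin.last s) = T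

/-- The `s`-shifted regret of the played points `ρ` against the utility functions `u`: the
supremum, over all splits into `s` phases and all choices of one point `ρs i` for each phase, of
`∑ i, ∑ t in phase i, (u_t (ρs i) - u_t (ρ_t))`. -/
noncomputable def shiftedRegret {C : Type*} {T : ℕ} (s : ℕ) (u : Fin T → C → ℝ)
    (ρ : Fin T → C) : ℝ :=
  sSup {r : ℝ | ∃ (τ : Fin (s + 1) → ℕ) (ρs : Fin s → C), IsPhaseSplit T s τ ∧
    r = ∑ i : Fin s,
      ∑ t ∈ Finset.univ.filter (fun t : Fin T => τ i.castSucc ≤ t.val ∧ t.val < τ i.succ),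
        (u t (ρs i) - u t (ρ t))}

/-- The expected `s`-shifted regret of the algorithm `A`, with seed distributed according to `μ`,
against the random sequence `u` of utility functions, whose outcome `ω` is drawn from the
distribution `p` independently of the seed. -/
noncomputable def expectedShiftedRegret {C Ξ Ω : Type*} [MeasurableSpace C] [MeasurableSpace Ξ]
    [Fintype Ω] {T : ℕ} (s : ℕ) (p : PMF Ω) (u : Ω → Fin T → C → ℝ)
    (A : OnlineAlgorithm C Ξ) (μ : Measure Ξ) : ℝ :=
  ∑ ω, (p ω).toReal * ∫ ξ, shiftedRegret s (u ω) (A.points (u ω) ξ) ∂μ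

/-!
All utilities are `{0, 1}`-valued step functions: round `t` has a threshold `θ t` and a fair bit that
says on which side of `θ t` the utility is `1`. As `θ t` depends only on earlier bits, every
algorithm earns exactly `1 / 2` per round in expectation (`le_expectedShiftedRegret`), so the
regret is bounded below by the advantage over `1 / 2` per round of a comparator that knows the bits.
A step function fails to be constant on a ball only if its threshold lies in it, so dispersion is a
matter of counting thresholds. Two families of thresholds give the two terms of the bound, and for
given `s`, `T`, `β` the one that belongs to the larger term is used.

* Thresholds `(t + 1) / (T + 1)`, spread evenly over `[0,1]`: for each of `s` phases of about `T / s`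
  rounds, the comparator is the better of the points `0` and `1`, which gains half the absolute value
  of a sum of about `T / s` fair signs, and this is of order `√(T / s)` in expectation
  (`le_sum_abs_sum_boolSign`). In total this is of order `√(s T)`.
* Bisections: in the `i`-th of `s` blocks of `N = ⌊T ^ (1 - β)⌋` rounds, the thresholds bisect
  `[i / s, (i + 1) / s]`, always keeping the half where the utility is `1`. The point reached at the
  end has utility `1` in all `N` rounds and gains `N / 2`, in total `s N / 2`. At most `N` thresholds
  lie in one of these intervals, whose length `1 / s` exceeds `3 T ^ (-β)`, so the sequence is
  dispersed. The remaining rounds have constant utilities.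
-/

/-! ### Fair bits -/

/-- A bit read as a sign: `true` is `1` and `false` is `-1`. -/
def boolSign (b : Bool) : ℝ := if b then 1 else -1

lemma boolSign_not (b : Bool) : boolSign (!b) = -boolSign b := by
  cases b <;> simp [boolSign]

lemma boolSign_sq (b : Bool) : boolSign b ^ 2 = 1 := by
  cases b <;> simp [boolSign]

/-- A fair sign is uncorrelated with whatever does not depend on it. -/
lemma sum_boolSign_mul_eq_zero {ι : Type*} [Fintype ι] [DecidableEq ι] (a : ι)
    (f : (ι → Bool) → ℝ) (hf : ∀ ω b, f (Function.update ω a b) = f ω) :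
    ∑ ω : ι → Bool, boolSign (ω a) * f ω = 0 := by
  have hinv : Function.Involutive
      (fun ω : ι → Bool => Function.update ω a (!(ω a))) := by
    intro ω
    simp
  have h := Equiv.sum_comp hinv.toPerm (fun ω : ι → Bool => boolSign (ω a) * f ω)
  simp only [Function.Involutive.coe_toPerm, Function.update_self, boolSign_not, hf,
    neg_mul, Finset.sum_neg_distrib] at h
  linarith

lemma sum_boolSign_update {ι : Type*} [DecidableEq ι] {S : Finset ι} {a : ι} (ha : a ∉ S)
    (ω : ι → Bool) (b : Bool) :
    ∑ t ∈ S, boolSign (Function.update ω a b t) = ∑ t ∈ S, boolSign (ω t) := by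
  refine Finset.sum_congr rfl fun t ht => ?_
  rw [Function.update_of_ne (ne_of_mem_of_not_mem ht ha)]

lemma sum_sq_sum_boolSign {ι : Type*} [Fintype ι] [DecidableEq ι] (S : Finset ι) :
    ∑ ω : ι → Bool, (∑ t ∈ S, boolSign (ω t)) ^ 2 = Fintype.card (ι → Bool) * (S.card : ℝ) := by
  induction S using Finset.induction_on with
  | empty => simp
  | insert a S ha ih =>
    have h0 := sum_boolSign_mul_eq_zero a (fun ω => ∑ t ∈ S, boolSign (ω t))
      (fun ω b => sum_boolSign_update ha ω b)
    have h1 : ∀ ω : ι → Bool, (∑ t ∈ insert a S, boolSign (ω t)) ^ 2 =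
        (∑ t ∈ S, boolSign (ω t)) ^ 2 + 2 * (boolSign (ω a) * ∑ t ∈ S, boolSign (ω t)) + 1 := by
      intro ω
      rw [Finset.sum_insert ha]
      linear_combination boolSign_sq (ω a)
    simp only [h1, Finset.sum_add_distrib, ← Finset.mul_sum, ih, h0, Finset.card_insert_of_notMem ha,
      Finset.sum_const, Finset.card_univ, nsmul_eq_mul]
    push_cast
    ring

lemma sum_pow_four_sum_boolSign_le {ι : Type*} [Fintype ι] [DecidableEq ι] (S : Finset ι) :
    ∑ ω : ι → Bool, (∑ t ∈ S, boolSign (ω t)) ^ 4 ≤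
      Fintype.card (ι → Bool) * (3 * (S.card : ℝ) ^ 2) := by
  induction S using Finset.induction_on with
  | empty => simp
  | insert a S ha ih =>
    have h0 := sum_boolSign_mul_eq_zero a
      (fun ω => 4 * (∑ t ∈ S, boolSign (ω t)) ^ 3 + 4 * ∑ t ∈ S, boolSign (ω t))
      (fun ω b => by simp only [sum_boolSign_update ha ω b])
    have h2 := sum_sq_sum_boolSign S
    have h1 : ∀ ω : ι → Bool, (∑ t ∈ insert a S, boolSign (ω t)) ^ 4 =
        (∑ t ∈ S, boolSign (ω t)) ^ 4 + 6 * (∑ t ∈ S, boolSign (ω t)) ^ 2 +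
          boolSign (ω a) * (4 * (∑ t ∈ S, boolSign (ω t)) ^ 3 + 4 * ∑ t ∈ S, boolSign (ω t))
          + 1 := by
      intro ω
      rw [Finset.sum_insert ha]
      set W := ∑ t ∈ S, boolSign (ω t)
      linear_combination (boolSign (ω a) ^ 2 + 1 + 6 * W ^ 2 + 4 * boolSign (ω a) * W) *
        boolSign_sq (ω a)
    simp only [h1, Finset.sum_add_distrib, ← Finset.mul_sum, h2, h0,
      Finset.card_insert_of_notMem ha, Finset.sum_const, Finset.card_univ, nsmul_eq_mul]
    push_cast
    have hC : (0 : ℝ) ≤ Fintype.card (ι → Bool) := Nat.cast_nonneg _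
    nlinarith

/-- Khintchine's lower bound for the first absolute moment of a sum of fair signs, from its second
and fourth moments. -/
lemma le_sum_abs_sum_boolSign {ι : Type*} [Fintype ι] [DecidableEq ι] (S : Finset ι) :
    Fintype.card (ι → Bool) * (Real.sqrt S.card / 4) ≤
      ∑ ω : ι → Bool, |∑ t ∈ S, boolSign (ω t)| := by
  rcases S.eq_empty_or_nonempty with rfl | hS
  · simp
  have hm : (0 : ℝ) < S.card := by exact_mod_cast hS.card_pos
  set r := Real.sqrt S.card with hr
  have hr0 : 0 < r := Real.sqrt_pos.2 hm
  have hrr : r ^ 2 = S.card := Real.sq_sqrt hm.le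
  -- The inequality `z ^ 2 - z ^ 4 / 4 ≤ z` for `z ≥ 0`, at `z = |W| / r`.
  have key : ∀ W : ℝ, W ^ 2 / r - W ^ 4 / (4 * r ^ 3) ≤ |W| := by
    intro W
    have hz : 0 ≤ |W| / r := by positivity
    have h3 : 0 ≤ (|W| / r) ^ 3 / 4 - |W| / r + 1 := by
      nlinarith [mul_nonneg hz (sq_nonneg (|W| / r - 1)), sq_nonneg (|W| / r - 5 / 4)]
    have h4 := mul_nonneg (abs_nonneg W) h3
    have h5 : |W| * ((|W| / r) ^ 3 / 4 - |W| / r + 1) =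
        |W| ^ 4 / (4 * r ^ 3) - |W| ^ 2 / r + |W| := by
      field_simp
    rw [h5, sq_abs, Even.pow_abs ⟨2, rfl⟩] at h4
    linarith
  have h2 := sum_sq_sum_boolSign S
  have h4 := sum_pow_four_sum_boolSign_le S
  set C : ℝ := (Fintype.card (ι → Bool) : ℝ)
  calc C * (r / 4) = (C * S.card) / r - (C * (3 * (S.card : ℝ) ^ 2)) / (4 * r ^ 3) := by
        rw [← hrr]
        field_simp
        ring
    _ ≤ (∑ ω : ι → Bool, (∑ t ∈ S, boolSign (ω t)) ^ 2) / r -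
          (∑ ω : ι → Bool, (∑ t ∈ S, boolSign (ω t)) ^ 4) / (4 * r ^ 3) := by
        rw [h2]
        gcongr
    _ = ∑ ω : ι → Bool, ((∑ t ∈ S, boolSign (ω t)) ^ 2 / r -
          (∑ t ∈ S, boolSign (ω t)) ^ 4 / (4 * r ^ 3)) := by
        rw [Finset.sum_sub_distrib, Finset.sum_div, Finset.sum_div]
    _ ≤ _ := Finset.sum_le_sum fun ω _ => key _

/-! ### Phases and shifted regret -/

/-- The phases of a split partition the rounds, so a sum over all phases is a sum over all
rounds. -/
lemma IsPhaseSplit.sum_phases {T s : ℕ} {τ : Fin (s + 1) → ℕ} (h : IsPhaseSplit T s τ)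
    (f : Fin T → ℝ) :
    ∑ i : Fin s, ∑ t ∈ Finset.univ.filter
      (fun t : Fin T => τ i.castSucc ≤ t.val ∧ t.val < τ i.succ), f t = ∑ t, f t := by
  obtain ⟨h0, hmono, hT⟩ := h
  simp only [Finset.sum_filter]
  rw [Finset.sum_comm]
  refine Finset.sum_congr rfl fun t _ => ?_
  -- The indicator of phase `i` is the difference of the indicators of `τ i ≤ t` and
  -- `τ (i + 1) ≤ t`, so the sum telescopes.
  let g : Fin (s + 1) → ℝ := fun i => if τ i ≤ t.val then f t else 0
  have h1 : ∀ i : Fin s, (if τ i.castSucc ≤ t.val ∧ t.val < τ i.succ then f t else 0) =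
      g i.castSucc - g i.succ := by
    intro i
    have hlt : τ i.castSucc < τ i.succ := hmono (Fin.castSucc_lt_succ)
    simp only [g]
    split_ifs <;> first | (exfalso; omega) | simp
  have h2 := Fin.sum_univ_succ g
  have h3 := Fin.sum_univ_castSucc g
  have h4 : g 0 = f t := by simp [g, h0]
  have h5 : g (Fin.last s) = 0 := by
    have := t.isLt
    simp only [g, hT]
    rw [if_neg (by omega)]
  rw [Finset.sum_congr rfl fun i _ => h1 i, Finset.sum_sub_distrib]
  linarith

/-- The starts of `s` phases of length `N`, the last of which is prolonged up to round `T`. -/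
def equalPhases (T s N : ℕ) (i : Fin (s + 1)) : ℕ := if i.val < s then i.val * N else T

lemma isPhaseSplit_equalPhases {T s N : ℕ} (hs : 1 ≤ s) (hN : 1 ≤ N) (hT : s * N ≤ T) :
    IsPhaseSplit T s (equalPhases T s N) := by
  refine ⟨by simp [equalPhases, show 0 < s by omega], ?_, by simp [equalPhases]⟩
  rw [Fin.strictMono_iff_lt_succ]
  intro i
  have hi := i.isLt
  simp only [equalPhases, Fin.val_castSucc, Fin.val_succ, hi, if_true]
  split_ifs with h
  · nlinarith
  · nlinarith

lemma le_shiftedRegret {C : Type*} {T s : ℕ} {u : Fin T → C → ℝ}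
    (hu : ∀ t x, u t x ∈ Set.Icc (0 : ℝ) 1) (ρ : Fin T → C) {τ : Fin (s + 1) → ℕ}
    (hτ : IsPhaseSplit T s τ) (ρs : Fin s → C) :
    ∑ i : Fin s, ∑ t ∈ Finset.univ.filter
      (fun t : Fin T => τ i.castSucc ≤ t.val ∧ t.val < τ i.succ), (u t (ρs i) - u t (ρ t)) ≤
      shiftedRegret s u ρ := by
  refine le_csSup ⟨T, ?_⟩ ⟨τ, ρs, hτ, rfl⟩
  rintro r ⟨σ, q, hσ, rfl⟩
  calc _ ≤ ∑ i : Fin s, ∑ t ∈ Finset.univ.filter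
            (fun t : Fin T => σ i.castSucc ≤ t.val ∧ t.val < σ i.succ), (1 : ℝ) := by
        refine Finset.sum_le_sum fun i _ => Finset.sum_le_sum fun t _ => ?_
        linarith [(hu t (q i)).2, (hu t (ρ t)).1]
    _ = T := by rw [hσ.sum_phases]; simp

/-- The played points enter the shifted regret only through their total utility. -/
lemma shiftedRegret_add_sum_le {C : Type*} {T s : ℕ} {u : Fin T → C → ℝ}
    (hu : ∀ t x, u t x ∈ Set.Icc (0 : ℝ) 1) (ρ ρ' : Fin T → C) (q : C) {τ : Fin (s + 1) → ℕ}
    (hτ : IsPhaseSplit T s τ) :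
    shiftedRegret s u ρ + ∑ t, u t (ρ t) ≤ shiftedRegret s u ρ' + ∑ t, u t (ρ' t) := by
  rw [← le_sub_iff_add_le]
  refine csSup_le ⟨_, τ, fun _ => q, hτ, rfl⟩ ?_
  rintro r ⟨σ, p, hσ, rfl⟩
  have h := le_shiftedRegret hu ρ' hσ p
  simp only [Finset.sum_sub_distrib, hσ.sum_phases (fun t => u t (ρ t)),
    hσ.sum_phases (fun t => u t (ρ' t))] at h ⊢
  linarith

lemma shiftedRegret_eq {C : Type*} {T s : ℕ} {u : Fin T → C → ℝ}
    (hu : ∀ t x, u t x ∈ Set.Icc (0 : ℝ) 1) (ρ ρ' : Fin T → C) (q : C) {τ : Fin (s + 1) → ℕ}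
    (hτ : IsPhaseSplit T s τ) :
    shiftedRegret s u ρ = shiftedRegret s u ρ' + ∑ t, u t (ρ' t) - ∑ t, u t (ρ t) := by
  linarith [shiftedRegret_add_sum_le hu ρ ρ' q hτ, shiftedRegret_add_sum_le hu ρ' ρ q hτ]

/-! ### Threshold utilities -/

/-- The utility with values in `{0, 1}` that is `1` to the left of the threshold `θ` if `b` is
`true`, and `1` from `θ` on to the right if `b` is `false`. -/
noncomputable def thresholdUtility (θ : ℝ) (b : Bool) (x : unitInterval) : ℝ :=
  if decide ((x : ℝ) < θ) = b then 1 else 0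

lemma thresholdUtility_mem (θ : ℝ) (b : Bool) (x : unitInterval) :
    thresholdUtility θ b x ∈ Set.Icc (0 : ℝ) 1 := by
  unfold thresholdUtility
  split_ifs <;> simp

/-- The side of the threshold `θ` on which `x` lies, as `1 / 2` (left) or `-1 / 2` (right). -/
noncomputable def thresholdSide (θ : ℝ) (x : unitInterval) : ℝ :=
  if (x : ℝ) < θ then 1 / 2 else -(1 / 2)

lemma thresholdUtility_eq (θ : ℝ) (b : Bool) (x : unitInterval) :
    thresholdUtility θ b x = 1 / 2 + boolSign b * thresholdSide θ x := by
  unfold thresholdUtility thresholdSide boolSign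
  by_cases h : (x : ℝ) < θ <;> cases b <;> simp [h] <;> norm_num

lemma measurable_thresholdSide (θ : ℝ) : Measurable (thresholdSide θ) :=
  Measurable.ite (measurableSet_lt measurable_subtype_coe measurable_const)
    measurable_const measurable_const

lemma measurable_thresholdUtility (θ : ℝ) (b : Bool) : Measurable (thresholdUtility θ b) := by
  rw [show thresholdUtility θ b = fun x => 1 / 2 + boolSign b * thresholdSide θ x from
    funext (thresholdUtility_eq θ b)]
  exact ((measurable_thresholdSide θ).const_mul _).const_add _

lemma isPiecewiseConstant_thresholdUtility (θ : ℝ) (b : Bool) :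
    IsPiecewiseConstant (thresholdUtility θ b) := by
  refine ⟨2, ![{x | (x : ℝ) < θ}, {x | θ ≤ (x : ℝ)}], ?_, ?_, ?_⟩
  · intro i
    fin_cases i
    · exact ⟨fun x _ y hy z hz => lt_of_le_of_lt (Subtype.coe_le_coe.2 hz.2) hy⟩
    · exact ⟨fun x hx y _ z hz => le_trans hx (Subtype.coe_le_coe.2 hz.1)⟩
  · ext x
    simp [Set.mem_iUnion, Fin.exists_fin_two, lt_or_ge]
  · intro i
    fin_cases i
    · intro x hx y hy
      have hx : (x : ℝ) < θ := hx
      have hy : (y : ℝ) < θ := hy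
      simp [thresholdUtility, hx, hy]
    · intro x hx y hy
      have hx : ¬ (x : ℝ) < θ := not_lt.2 hx
      have hy : ¬ (y : ℝ) < θ := not_lt.2 hy
      simp [thresholdUtility, hx, hy]

lemma abs_threshold_sub_le_of_not_lipschitz {θ : ℝ} {b : Bool} {ρ : unitInterval} {ε : ℝ}
    (h : ¬ LipschitzOnWith 0 (thresholdUtility θ b) (Metric.closedBall ρ ε)) :
    |θ - ρ| ≤ ε ∧ 0 < θ := by
  by_contra hc
  refine h (LipschitzOnWith.of_dist_le_mul fun x hx y hy => ?_)
  rw [Metric.mem_closedBall, Subtype.dist_eq, Real.dist_eq, abs_le] at hx hy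
  have hx0 := x.2.1
  have hy0 := y.2.1
  have hxy : (x : ℝ) < θ ↔ (y : ℝ) < θ := by
    rw [not_and_or, not_le, lt_abs, not_lt] at hc
    rcases hc with (hc | hc) | hc <;> constructor <;> intro h <;> linarith
  simp [thresholdUtility, hxy]

lemma card_le_of_val_mem_Icc {T : ℕ} {S : Set (Fin T)} {a b : ℝ} (hab : a ≤ b)
    (h : ∀ t ∈ S, a ≤ (t.val : ℝ) ∧ (t.val : ℝ) ≤ b) : (S.ncard : ℝ) ≤ b - a + 1 := by
  have h1 : S.ncard ≤ ((Finset.Icc ⌈a⌉ ⌊b⌋ : Finset ℤ) : Set ℤ).ncard := by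
    refine Set.ncard_le_ncard_of_injOn (fun t => (t.val : ℤ)) (fun t ht => ?_) ?_
    · simp only [Finset.coe_Icc, Set.mem_Icc, Int.ceil_le, Int.le_floor, Int.cast_natCast]
      exact h t ht
    · intro x _ y _ hxy
      exact Fin.ext (Int.ofNat_inj.1 hxy)
  rw [Set.ncard_coe_finset, Int.card_Icc] at h1
  have h2 : (S.ncard : ℝ) ≤ ((⌊b⌋ + 1 - ⌈a⌉).toNat : ℝ) := by exact_mod_cast h1
  have h3 : ((⌊b⌋ + 1 - ⌈a⌉).toNat : ℝ) = ((max (⌊b⌋ + 1 - ⌈a⌉) 0 : ℤ) : ℝ) := by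
    rw [← Int.ofNat_toNat, Int.cast_natCast]
  rw [h3] at h2
  refine h2.trans ?_
  rw [Int.cast_max]
  refine max_le ?_ (by simp; linarith)
  push_cast
  linarith [Int.floor_le b, Int.le_ceil a]

/-! ### The regret of an algorithm against fair bits -/

/-- The threshold of round `t` is determined by the bits of the rounds before `t`. -/
def IsNonanticipating {T : ℕ} (θ : Fin T → (Fin T → Bool) → ℝ) : Prop :=
  ∀ t ω ω', (∀ j < t, ω j = ω' j) → θ t ω = θ t ω'

/-- The utilities of the thresholds `θ`, each oriented by the bit of its own round. -/
noncomputable def bitUtility {T : ℕ} (θ : Fin T → (Fin T → Bool) → ℝ) (ω : Fin T → Bool)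
    (t : Fin T) : unitInterval → ℝ :=
  thresholdUtility (θ t ω) (ω t)

/-- Against fair bits every algorithm collects `1 / 2` per round in expectation, so its expected
regret is at least the expected advantage of any comparator over `1 / 2` per round. -/
lemma le_expectedShiftedRegret {Ξ : Type*} [MeasurableSpace Ξ] (μ : Measure Ξ)
    [IsProbabilityMeasure μ] (A : OnlineAlgorithm unitInterval Ξ) {T s : ℕ}
    {θ : Fin T → (Fin T → Bool) → ℝ} (hθ : IsNonanticipating θ) {τ : Fin (s + 1) → ℕ}
    (hτ : IsPhaseSplit T s τ) (ρs : (Fin T → Bool) → Fin s → unitInterval) {B : ℝ}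
    (hB : Fintype.card (Fin T → Bool) * B ≤
      ∑ ω : Fin T → Bool, ∑ i : Fin s, ∑ t ∈ Finset.univ.filter
        (fun t : Fin T => τ i.castSucc ≤ t.val ∧ t.val < τ i.succ),
          boolSign (ω t) * thresholdSide (θ t ω) (ρs ω i)) :
    B ≤ expectedShiftedRegret s (PMF.uniformOfFintype (Fin T → Bool)) (bitUtility θ) A μ := by
  have hu : ∀ ω t x, bitUtility θ ω t x ∈ Set.Icc (0 : ℝ) 1 :=
    fun ω t x => thresholdUtility_mem _ _ _
  have hmeas : ∀ ω t, Measurable (fun ξ => A.points (bitUtility θ ω) ξ t) :=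
    fun ω t => A.measurable_play _ _
  have hint : ∀ ω t, Integrable
      (fun ξ => bitUtility θ ω t (A.points (bitUtility θ ω) ξ t)) μ := by
    intro ω t
    refine Integrable.of_bound
      ((measurable_thresholdUtility _ _).comp (hmeas ω t)).aestronglyMeasurable 1
      (Filter.Eventually.of_forall fun ξ => ?_)
    have := hu ω t (A.points (bitUtility θ ω) ξ t)
    rw [Real.norm_eq_abs, abs_of_nonneg this.1]
    exact this.2
  have hintS : ∀ ω t, Integrable
      (fun ξ => thresholdSide (θ t ω) (A.points (bitUtility θ ω) ξ t)) μ := by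
    intro ω t
    refine Integrable.of_bound
      ((measurable_thresholdSide _).comp (hmeas ω t)).aestronglyMeasurable (1 / 2)
      (Filter.Eventually.of_forall fun ξ => ?_)
    unfold thresholdSide
    split_ifs <;> norm_num
  -- The expected side (`1 / 2` or `-1 / 2`) on which the algorithm plays in round `t`.
  let m : Fin T → (Fin T → Bool) → ℝ := fun t ω =>
    ∫ ξ, thresholdSide (θ t ω) (A.points (bitUtility θ ω) ξ t) ∂μ
  have hm : ∀ t, ∑ ω : Fin T → Bool, boolSign (ω t) * m t ω = 0 := by
    intro t
    refine sum_boolSign_mul_eq_zero t _ fun ω b => ?_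
    have hne : ∀ j < t, Function.update ω t b j = ω j := fun j hj =>
      Function.update_of_ne hj.ne _ _
    have h1 : θ t (Function.update ω t b) = θ t ω := hθ _ _ _ hne
    have h2 : ∀ ξ, A.points (bitUtility θ (Function.update ω t b)) ξ t =
        A.points (bitUtility θ ω) ξ t := by
      intro ξ
      unfold OnlineAlgorithm.points
      congr 1
      funext i
      have hi : Fin.castLE t.isLt.le i < t := i.isLt
      unfold bitUtility
      rw [hne _ hi, hθ _ _ ω fun j hj => hne j (hj.trans hi)]
    simp only [m, h1, h2]
  have hlow : ∀ ω, ∑ i : Fin s, ∑ t ∈ Finset.univ.filter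
        (fun t : Fin T => τ i.castSucc ≤ t.val ∧ t.val < τ i.succ),
          boolSign (ω t) * thresholdSide (θ t ω) (ρs ω i) - ∑ t, boolSign (ω t) * m t ω ≤
      ∫ ξ, shiftedRegret s (bitUtility θ ω) (A.points (bitUtility θ ω) ξ) ∂μ := by
    intro ω
    have hIS : Integrable
        (fun ξ => shiftedRegret s (bitUtility θ ω) (A.points (bitUtility θ ω) ξ)) μ := by
      refine ((integrable_const _).sub
        (integrable_finsetSum Finset.univ fun t _ => hint ω t)).congr
        (Filter.Eventually.of_forall fun ξ =>
          (shiftedRegret_eq (hu ω) _ (fun _ => (0 : unitInterval)) 0 hτ).symm)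
    have hI2 : Integrable (fun ξ => ∑ t, boolSign (ω t) *
        thresholdSide (θ t ω) (A.points (bitUtility θ ω) ξ t)) μ :=
      integrable_finsetSum Finset.univ fun t _ => (hintS ω t).const_mul _
    have heq : ∑ t, boolSign (ω t) * m t ω = ∫ ξ, ∑ t, boolSign (ω t) *
        thresholdSide (θ t ω) (A.points (bitUtility θ ω) ξ t) ∂μ := by
      rw [integral_finsetSum _ fun t _ => (hintS ω t).const_mul _]
      simp only [integral_const_mul, m]
    rw [heq]
    set D := ∑ i : Fin s, ∑ t ∈ Finset.univ.filter
        (fun t : Fin T => τ i.castSucc ≤ t.val ∧ t.val < τ i.succ),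
          boolSign (ω t) * thresholdSide (θ t ω) (ρs ω i) with hD
    have hDi : D = ∫ _ξ, D ∂μ := by simp
    rw [hDi, ← integral_sub (integrable_const _) hI2]
    refine integral_mono ((integrable_const _).sub hI2) hIS fun ξ => ?_
    refine le_trans (le_of_eq ?_) (le_shiftedRegret (hu ω) _ hτ (ρs ω))
    dsimp only
    rw [hD, ← hτ.sum_phases, ← Finset.sum_sub_distrib]
    refine Finset.sum_congr rfl fun i _ => ?_
    rw [← Finset.sum_sub_distrib]
    refine Finset.sum_congr rfl fun t _ => ?_
    simp only [bitUtility, thresholdUtility_eq]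
    ring
  unfold expectedShiftedRegret
  have hC : (0 : ℝ) < Fintype.card (Fin T → Bool) := by
    exact_mod_cast Fintype.card_pos
  simp only [PMF.uniformOfFintype_apply, ENNReal.toReal_inv, ENNReal.toReal_natCast]
  rw [← Finset.mul_sum, ← div_eq_inv_mul, le_div_iff₀ hC, mul_comm]
  refine le_trans ?_ (Finset.sum_le_sum fun ω _ => hlow ω)
  rw [Finset.sum_sub_distrib, Finset.sum_comm (f := fun ω t => boolSign (ω t) * m t ω)]
  simp only [hm, Finset.sum_const_zero, sub_zero]
  exact hB

/-! ### Spread thresholds -/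

/-- The thresholds `1 / (T + 1), …, T / (T + 1)`, which do not depend on the bits. -/
noncomputable def spreadThreshold (T : ℕ) (t : Fin T) (_ω : Fin T → Bool) : ℝ :=
  ((t.val : ℝ) + 1) / (T + 1)

lemma le_card_equalPhases {T s N : ℕ} (hT : s * N ≤ T) (i : Fin s) :
    N ≤ (Finset.univ.filter (fun t : Fin T => equalPhases T s N i.castSucc ≤ t.val ∧
      t.val < equalPhases T s N i.succ)).card := by
  have hi := i.isLt
  have h1 : (i.val + 1) * N ≤ T := (Nat.mul_le_mul_right N hi).trans hT
  rw [add_mul, one_mul] at h1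
  have h2 : i.val * N + N ≤ equalPhases T s N i.succ := by
    simp only [equalPhases, Fin.val_succ]
    split_ifs
    · rw [add_mul, one_mul]
    · exact h1
  conv_lhs => rw [← Fintype.card_fin N, ← Finset.card_univ]
  refine Finset.card_le_card_of_injOn (fun k => ⟨i.val * N + k.val, by omega⟩) ?_ ?_
  · intro k _
    have h3 : equalPhases T s N i.castSucc = i.val * N := by simp [equalPhases]
    simp only [Finset.coe_filter, Finset.mem_univ, true_and, Set.mem_ofPred_eq, h3]
    omega
  · intro k _ k' _ h
    simp only [Fin.mk.injEq] at h
    exact Fin.ext (by omega)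

/-- In each phase the better of the two end points of `[0,1]` beats `1 / 2` per round by half the
absolute value of the sum of the signs of the phase. -/
lemma le_expectedShiftedRegret_spread {Ξ : Type*} [MeasurableSpace Ξ] (μ : Measure Ξ)
    [IsProbabilityMeasure μ] (A : OnlineAlgorithm unitInterval Ξ) {T s N : ℕ} (hs : 1 ≤ s)
    (hN : 1 ≤ N) (hT : s * N ≤ T) :
    s * Real.sqrt N / 8 ≤ expectedShiftedRegret s (PMF.uniformOfFintype (Fin T → Bool))
      (bitUtility (spreadThreshold T)) A μ := by
  let P : Fin s → Finset (Fin T) := fun i => Finset.univ.filter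
    (fun t : Fin T => equalPhases T s N i.castSucc ≤ t.val ∧ t.val < equalPhases T s N i.succ)
  let W : (Fin T → Bool) → Fin s → ℝ := fun ω i => ∑ t ∈ P i, boolSign (ω t)
  refine le_expectedShiftedRegret μ A (fun _ _ _ _ => rfl) (isPhaseSplit_equalPhases hs hN hT)
    (fun ω i => if 0 ≤ W ω i then 0 else 1) ?_
  have hside : ∀ ω i, ∑ t ∈ P i, boolSign (ω t) *
      thresholdSide (spreadThreshold T t ω) (if 0 ≤ W ω i then 0 else 1) = |W ω i| / 2 := by
    intro ω i
    have hpos : ∀ t : Fin T, 0 < spreadThreshold T t ω := fun t => by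
      unfold spreadThreshold; positivity
    have hlt : ∀ t : Fin T, spreadThreshold T t ω < 1 := fun t => by
      have : (t.val : ℝ) < T := by exact_mod_cast t.isLt
      unfold spreadThreshold
      rw [div_lt_one (by positivity)]
      linarith
    split_ifs with h
    · simp only [thresholdSide, Set.Icc.coe_zero, hpos, if_true]
      rw [← Finset.sum_mul, abs_of_nonneg h]
      simp only [W]
      ring
    · simp only [thresholdSide, Set.Icc.coe_one, (hlt _).not_gt, if_false]
      rw [← Finset.sum_mul, abs_of_neg (not_le.1 h)]
      simp only [W]
      ring
  simp only [P] at hside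
  simp only [hside]
  rw [Finset.sum_comm]
  calc _ = ∑ _i : Fin s, (Fintype.card (Fin T → Bool) : ℝ) * (Real.sqrt N / 4) / 2 := by
        simp only [Finset.sum_const, Finset.card_univ, Fintype.card_fin, nsmul_eq_mul]
        ring
    _ ≤ _ := by
        refine Finset.sum_le_sum fun i _ => ?_
        rw [← Finset.sum_div]
        refine div_le_div_of_nonneg_right (le_trans ?_ (le_sum_abs_sum_boolSign (P i))) two_pos.le
        have := le_card_equalPhases hT i
        gcongr

lemma isDispersed_spread {T : ℕ} (hT : 2 ≤ T) {β : ℝ} (hβ : β ≤ 1) (ω : Fin T → Bool) :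
    IsDispersed β 0 4 (bitUtility (spreadThreshold T) ω) := by
  intro ε hε ρ
  have hT' : (2 : ℝ) ≤ T := by exact_mod_cast hT
  have hε1 : 1 ≤ ε * T := by
    have h1 : (T : ℝ) ^ (-1 : ℝ) ≤ (T : ℝ) ^ (-β) :=
      Real.rpow_le_rpow_of_exponent_le (by linarith) (by linarith)
    rw [Real.rpow_neg_one] at h1
    calc (1 : ℝ) = (T : ℝ)⁻¹ * T := by field_simp
      _ ≤ ε * T := by gcongr; exact h1.trans hε
  have hε0 : 0 < ε := by
    by_contra h
    nlinarith
  have hT1 : (0 : ℝ) < T + 1 := by linarith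
  refine (card_le_of_val_mem_Icc (a := (ρ - ε) * (T + 1) - 1) (b := (ρ + ε) * (T + 1) - 1)
    (by nlinarith) fun t ht => ?_).trans (by nlinarith)
  obtain ⟨h, -⟩ := abs_threshold_sub_le_of_not_lipschitz ht
  rw [abs_le] at h
  have h1 : ρ - ε ≤ spreadThreshold T t ω := by linarith
  have h2 : spreadThreshold T t ω ≤ ρ + ε := by linarith
  unfold spreadThreshold at h1 h2
  rw [le_div_iff₀ hT1] at h1
  rw [div_le_iff₀ hT1] at h2
  constructor <;> linarith

/-! ### Bisecting thresholds -/

/-- The left end point of the dyadic interval of length `2 ^ (-k)` that is reached from `[0,1]` by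
`k` bisections, the `j`-th of which keeps the left half if `b j` is `true` and the right half
otherwise. -/
noncomputable def dyadicLeft (b : ℕ → Bool) : ℕ → ℝ
  | 0 => 0
  | k + 1 => dyadicLeft b k + if b k then 0 else (1 / 2) ^ (k + 1)

lemma dyadicLeft_congr {b b' : ℕ → Bool} {k : ℕ} (h : ∀ j < k, b j = b' j) :
    dyadicLeft b k = dyadicLeft b' k := by
  induction k with
  | zero => rfl
  | succ k ih =>
    simp only [dyadicLeft, ih fun j hj => h j (by omega), h k (by omega)]

lemma dyadicLeft_mono (b : ℕ → Bool) : Monotone (dyadicLeft b) := by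
  refine monotone_nat_of_le_succ fun k => ?_
  simp only [dyadicLeft]
  split_ifs
  · simp
  · simp

lemma dyadicLeft_add_antitone (b : ℕ → Bool) :
    Antitone fun k => dyadicLeft b k + (1 / 2 : ℝ) ^ k := by
  refine antitone_nat_of_succ_le fun k => ?_
  have h : (0 : ℝ) < (1 / 2) ^ k := by positivity
  simp only [dyadicLeft, pow_succ]
  split_ifs <;> linarith

lemma dyadicLeft_nonneg (b : ℕ → Bool) (k : ℕ) : 0 ≤ dyadicLeft b k :=
  dyadicLeft_mono b (Nat.zero_le k)

lemma dyadicLeft_add_le_one (b : ℕ → Bool) (k : ℕ) :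
    dyadicLeft b k + (1 / 2 : ℝ) ^ k ≤ 1 := by
  simpa [dyadicLeft] using dyadicLeft_add_antitone b (Nat.zero_le k)

/-- The point reached by `N` bisections lies to the left of the `k`-th midpoint exactly if the
`k`-th bisection keeps the left half. -/
lemma dyadicLeft_lt_iff (b : ℕ → Bool) {k N : ℕ} (hk : k < N) :
    dyadicLeft b N < dyadicLeft b k + (1 / 2 : ℝ) ^ (k + 1) ↔ b k = true := by
  have h1 := dyadicLeft_mono b (Nat.succ_le_of_lt hk)
  have h2 := dyadicLeft_add_antitone b (Nat.succ_le_of_lt hk)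
  have h3 : (0 : ℝ) < (1 / 2) ^ N := by positivity
  simp only [dyadicLeft, Nat.succ_eq_add_one] at h1 h2
  cases hb : b k <;> simp only [hb] at h1 h2 ⊢
  · simp only [Bool.false_eq_true, if_false, iff_false, not_lt] at h1 ⊢
    exact h1
  · simp only [if_true, iff_true] at h2 ⊢
    linarith

/-- The bits from round `a` on; past the last round they are `false`. -/
def bitsFrom {T : ℕ} (ω : Fin T → Bool) (a j : ℕ) : Bool :=
  if h : a + j < T then ω ⟨a + j, h⟩ else false

/-- For `s` consecutive blocks of `N` rounds, the thresholds of block `i` bisect the interval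
`[i / s, (i + 1) / s]`, always keeping the half on which the last utility is `1`. After the blocks
the threshold is `0`, which makes the utility constant. -/
noncomputable def bisectThreshold (T s N : ℕ) (t : Fin T) (ω : Fin T → Bool) : ℝ :=
  if t.val < s * N then
    ((t.val / N : ℕ) + (dyadicLeft (bitsFrom ω (t.val / N * N)) (t.val % N) +
      (1 / 2) ^ (t.val % N + 1))) / s
  else 0

lemma isNonanticipating_bisect (T s N : ℕ) : IsNonanticipating (bisectThreshold T s N) := by
  intro t ω ω' h
  unfold bisectThreshold
  split_ifs
  · rw [dyadicLeft_congr fun j hj => ?_]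
    have hlt : t.val / N * N + j < t.val := by
      have := Nat.div_add_mod' t.val N
      omega
    have hT : t.val / N * N + j < T := hlt.trans t.isLt
    simp only [bitsFrom, hT, dif_pos]
    exact h _ hlt
  · rfl

/-- Every utility of a block is `1` at the point that the `N` bisections of the block reach,
so this point gains `1 / 2` per round. -/
lemma le_expectedShiftedRegret_bisect {Ξ : Type*} [MeasurableSpace Ξ] (μ : Measure Ξ)
    [IsProbabilityMeasure μ] (A : OnlineAlgorithm unitInterval Ξ) {T s N : ℕ} (hs : 1 ≤ s)
    (hN : 1 ≤ N) (hT : s * N ≤ T) :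
    (s * N : ℝ) / 2 ≤ expectedShiftedRegret s (PMF.uniformOfFintype (Fin T → Bool))
      (bitUtility (bisectThreshold T s N)) A μ := by
  have hs0 : (0 : ℝ) < s := by exact_mod_cast hs
  have hτ := isPhaseSplit_equalPhases hs hN hT
  have hmem : ∀ (ω : Fin T → Bool) (i : Fin s),
      ((i.val : ℝ) + dyadicLeft (bitsFrom ω (i.val * N)) N) / s ∈ unitInterval := by
    intro ω i
    have h1 := dyadicLeft_nonneg (bitsFrom ω (i.val * N)) N
    have h2 := dyadicLeft_add_le_one (bitsFrom ω (i.val * N)) N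
    have h3 : (0 : ℝ) < (1 / 2) ^ N := by positivity
    have h4 : (i.val : ℝ) + 1 ≤ s := by exact_mod_cast i.isLt
    refine ⟨by positivity, ?_⟩
    rw [div_le_one hs0]
    linarith
  refine le_expectedShiftedRegret μ A (isNonanticipating_bisect T s N) hτ
    (fun ω i => ⟨_, hmem ω i⟩) ?_
  set C : ℝ := (Fintype.card (Fin T → Bool) : ℝ) with hC
  have hgain : ∀ i : Fin s, ∀ t ∈ Finset.univ.filter (fun t : Fin T =>
      equalPhases T s N i.castSucc ≤ t.val ∧ t.val < equalPhases T s N i.succ),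
      ∑ ω : Fin T → Bool, boolSign (ω t) *
        thresholdSide (bisectThreshold T s N t ω) ⟨_, hmem ω i⟩ =
      if t.val < s * N then C / 2 else 0 := by
    intro i t ht
    simp only [Finset.mem_filter, Finset.mem_univ, true_and] at ht
    split_ifs with htN
    · have hi : t.val / N = i.val := by
        have hi := i.isLt
        rw [Nat.div_eq_iff (by omega)]
        simp only [equalPhases, Fin.val_castSucc, hi, if_true, Fin.val_succ] at ht
        have h2 : t.val < (i.val + 1) * N := by
          split_ifs at ht with h
          · exact ht.2
          · rwa [show i.val + 1 = s by omega]
        rw [add_mul, one_mul] at h2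
        omega
      have h1 : ∀ ω : Fin T → Bool, boolSign (ω t) *
          thresholdSide (bisectThreshold T s N t ω) ⟨_, hmem ω i⟩ = 1 / 2 := by
        intro ω
        have hb : bitsFrom ω (i.val * N) (t.val % N) = ω t := by
          have h3 : i.val * N + t.val % N = t.val := by rw [← hi, Nat.div_add_mod']
          simp only [bitsFrom, h3, t.isLt, dif_pos, Fin.eta]
        have hiff := dyadicLeft_lt_iff (bitsFrom ω (i.val * N)) (Nat.mod_lt t.val (by omega : N > 0))
        rw [hb] at hiff
        simp only [thresholdSide, bisectThreshold, htN, if_true, hi, div_lt_div_iff_of_pos_right hs0,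
          add_lt_add_iff_left, hiff]
        cases ω t <;> simp [boolSign]
      simp only [h1, Finset.sum_const, Finset.card_univ, nsmul_eq_mul, hC]
      ring
    · have h1 : ∀ ω : Fin T → Bool,
          thresholdSide (bisectThreshold T s N t ω) ⟨_, hmem ω i⟩ = -(1 / 2) := by
        intro ω
        simp only [thresholdSide, bisectThreshold, htN, if_false, not_lt.2 (hmem ω i).1]
      simp only [h1]
      exact sum_boolSign_mul_eq_zero t (fun _ => -(1 / 2)) fun _ _ => rfl
  rw [Finset.sum_comm, Finset.sum_congr rfl fun i _ =>
    Finset.sum_comm.trans (Finset.sum_congr rfl (hgain i)), hτ.sum_phases,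
    Fin.sum_univ_eq_sum_range (fun t => if t < s * N then C / 2 else 0) T, ← Finset.sum_filter]
  have hr : (Finset.range T).filter (fun t => t < s * N) = Finset.range (s * N) := by
    ext t
    simp only [Finset.mem_filter, Finset.mem_range]
    omega
  rw [hr, Finset.sum_const, Finset.card_range, nsmul_eq_mul]
  push_cast
  linarith

lemma isDispersed_bisect {T s N : ℕ} (hs : 1 ≤ s) (hN : 1 ≤ N) {β : ℝ} (hT : 0 < T)
    (hsβ : 3 * (s : ℝ) ≤ (T : ℝ) ^ β) (hNβ : (N : ℝ) ≤ (T : ℝ) ^ (1 - β))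
    (ω : Fin T → Bool) : IsDispersed β 0 4 (bitUtility (bisectThreshold T s N) ω) := by
  intro ε hε ρ
  have hT' : (0 : ℝ) < T := by exact_mod_cast hT
  have hs0 : (0 : ℝ) < s := by exact_mod_cast hs
  have hN0 : (1 : ℝ) ≤ N := by exact_mod_cast hN
  have hε0 : 0 < ε := lt_of_lt_of_le (Real.rpow_pos_of_pos hT' _) hε
  have hNε : (N : ℝ) ≤ ε * T := by
    refine hNβ.trans ?_
    rw [sub_eq_add_neg, add_comm, Real.rpow_add hT', Real.rpow_one]
    gcongr
  have hsN : 3 * (s * N : ℝ) ≤ T := by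
    calc 3 * (s * N : ℝ) = (3 * s) * N := by ring
      _ ≤ (T : ℝ) ^ β * (T : ℝ) ^ (1 - β) := by gcongr
      _ = T := by rw [← Real.rpow_add hT']; simp
  -- An interval of length `2 * ε` meets the ranges of at most `2 * ε * s + 2` consecutive blocks.
  refine (card_le_of_val_mem_Icc (a := (s * (ρ - ε) - 1) * N) (b := (s * (ρ + ε) + 1) * N)
    ?_ fun t ht => ?_).trans ?_
  · have : 0 < s * ε := by positivity
    nlinarith
  · obtain ⟨h, hpos⟩ := abs_threshold_sub_le_of_not_lipschitz ht
    have htN : t.val < s * N := by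
      by_contra hc
      simp [bisectThreshold, hc] at hpos
    set b := bitsFrom ω (t.val / N * N)
    set k := t.val % N
    have hθ : bisectThreshold T s N t ω =
        ((t.val / N : ℕ) + (dyadicLeft b k + (1 / 2) ^ (k + 1))) / s := by
      simp only [bisectThreshold, htN, if_true, b, k]
    have h1 := dyadicLeft_nonneg b k
    have h2 := dyadicLeft_add_le_one b k
    have h3 : (0 : ℝ) < (1 / 2) ^ k := by positivity
    rw [abs_le] at h
    have h4 : ρ - ε ≤ bisectThreshold T s N t ω := by linarith
    have h5 : bisectThreshold T s N t ω ≤ ρ + ε := by linarith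
    rw [hθ, pow_succ] at h4 h5
    rw [le_div_iff₀ hs0] at h4
    rw [div_le_iff₀ hs0] at h5
    have h6 : ((t.val / N : ℕ) : ℝ) * N ≤ t.val := by
      exact_mod_cast Nat.div_mul_le_self t.val N
    have h7 : (t.val : ℝ) ≤ ((t.val / N : ℕ) + 1) * N := by
      exact_mod_cast (Nat.lt_mul_of_div_lt (Nat.lt_succ_self (t.val / N)) hN).le
    constructor
    · refine le_trans ?_ h6
      gcongr
      linarith
    · refine h7.trans ?_
      gcongr
      linarith
  · nlinarith

/-! ### The lower bound -/

theorem theorem5 :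
    ∃ c K : ℝ, 0 < c ∧ 0 < K ∧
      ∀ (s T : ℕ) (β : ℝ), 1 ≤ s → 2 ≤ T →
        Real.log (3 * (s : ℝ)) / Real.log (T : ℝ) < β → β ≤ 1 →
        ∃ (Ω : Type) (_ : Fintype Ω) (p : PMF Ω) (u : Ω → Fin T → unitInterval → ℝ),
          (∀ ω t x, u ω t x ∈ Set.Icc (0 : ℝ) 1) ∧
          (∀ ω t, IsPiecewiseConstant (u ω t)) ∧
          (∀ ω, IsDispersed β 0 K (u ω)) ∧
          ∀ (Ξ : Type*) [MeasurableSpace Ξ] (μ : Measure Ξ) [IsProbabilityMeasure μ]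
            (A : OnlineAlgorithm unitInterval Ξ),
            c * (Real.sqrt (s * T) + s * (T : ℝ) ^ (1 - β)) ≤
              expectedShiftedRegret s p u A μ := by
  refine ⟨1 / 32, 4, by norm_num, by norm_num, ?_⟩
  intro s T β hs hT hβ hβ1
  have hs0 : (0 : ℝ) < s := by exact_mod_cast hs
  have hT1 : (1 : ℝ) < T := by exact_mod_cast hT
  have hT0 : (0 : ℝ) < T := by linarith
  have hsβ : 3 * (s : ℝ) ≤ (T : ℝ) ^ β := by
    rw [div_lt_iff₀ (Real.log_pos hT1)] at hβ
    exact (Real.lt_rpow_of_log_lt hT0 hβ).le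
  have hsT : 3 * (s : ℝ) ≤ T := by
    refine hsβ.trans ?_
    simpa using Real.rpow_le_rpow_of_exponent_le hT1.le hβ1
  have half_floor : ∀ x : ℝ, 1 ≤ x → x / 2 ≤ (⌊x⌋₊ : ℝ) := by
    intro x hx
    have h1 := Nat.lt_floor_add_one x
    have h2 : (1 : ℝ) ≤ ⌊x⌋₊ := by exact_mod_cast Nat.one_le_floor_iff x |>.2 hx
    linarith
  -- One of the two terms is at least half of their sum.
  rcases le_total (s * (T : ℝ) ^ (1 - β)) (Real.sqrt (s * T)) with hle | hle
  · refine ⟨Fin T → Bool, inferInstance, PMF.uniformOfFintype _, bitUtility (spreadThreshold T),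
      fun _ _ _ => thresholdUtility_mem _ _ _, fun _ _ => isPiecewiseConstant_thresholdUtility _ _,
      isDispersed_spread hT hβ1, fun Ξ _ μ _ A => ?_⟩
    have hx : (1 : ℝ) ≤ T / s := by
      rw [le_div_iff₀ hs0]
      linarith
    have hfl := half_floor _ hx
    have hN : 1 ≤ ⌊(T / s : ℝ)⌋₊ := (Nat.one_le_floor_iff _).2 hx
    have hsN : s * ⌊(T / s : ℝ)⌋₊ ≤ T := by
      have h := Nat.floor_le (show (0 : ℝ) ≤ T / s by positivity)
      rw [le_div_iff₀ hs0] at h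
      rw [mul_comm]
      exact_mod_cast h
    refine le_trans ?_ (le_expectedShiftedRegret_spread μ A hs hN hsN)
    have h1 : Real.sqrt (s * T) / 2 ≤ s * Real.sqrt ⌊(T / s : ℝ)⌋₊ := by
      rw [div_le_iff₀ two_pos]
      refine Real.sqrt_le_iff.2 ⟨by positivity, ?_⟩
      rw [mul_pow, mul_pow, Real.sq_sqrt (Nat.cast_nonneg _)]
      have h2 : (s : ℝ) ^ 2 * (T / s / 2) ≤ (s : ℝ) ^ 2 * ⌊(T / s : ℝ)⌋₊ := by gcongr
      have h3 : (s : ℝ) ^ 2 * (T / s / 2) = s * T / 2 := by field_simp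
      have h4 : (0 : ℝ) < s * T := by positivity
      linarith
    linarith
  · have hx : (1 : ℝ) ≤ (T : ℝ) ^ (1 - β) := Real.one_le_rpow hT1.le (by linarith)
    have hfl := half_floor _ hx
    have hN : 1 ≤ ⌊(T : ℝ) ^ (1 - β)⌋₊ := (Nat.one_le_floor_iff _).2 hx
    have hNβ := Nat.floor_le (show (0 : ℝ) ≤ (T : ℝ) ^ (1 - β) by positivity)
    have hsN : s * ⌊(T : ℝ) ^ (1 - β)⌋₊ ≤ T := by
      have h : (s : ℝ) * ⌊(T : ℝ) ^ (1 - β)⌋₊ ≤ T := by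
        calc _ ≤ (T : ℝ) ^ β * (T : ℝ) ^ (1 - β) := by
              gcongr
              linarith
          _ = T := by rw [← Real.rpow_add hT0]; simp
      exact_mod_cast h
    refine ⟨Fin T → Bool, inferInstance, PMF.uniformOfFintype _,
      bitUtility (bisectThreshold T s ⌊(T : ℝ) ^ (1 - β)⌋₊),
      fun _ _ _ => thresholdUtility_mem _ _ _, fun _ _ => isPiecewiseConstant_thresholdUtility _ _,
      isDispersed_bisect hs hN (by omega) hsβ hNβ, fun Ξ _ μ _ A => ?_⟩
    refine le_trans ?_ (le_expectedShiftedRegret_bisect μ A hs hN hsN)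
    have h1 : (s : ℝ) * ((T : ℝ) ^ (1 - β) / 2) ≤ s * ⌊(T : ℝ) ^ (1 - β)⌋₊ := by gcongr
    have h2 : (0 : ℝ) ≤ Real.sqrt (s * T) := Real.sqrt_nonneg _
    linarith
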